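/- Let $p$ be a prime and let $(R,\mathfrak m,k)$ be a Noetherian local ring of characteristic $p$ and Krull dimension $d$ that is Gorenstein (that is, $R$ has finite injective dimension as an $R$-module). For $e\ge 0$ put $q=p^e$, let $R^{(e)}$ be the $R$-algebra that is $R$ as a ring, with $r\in R$ acting as multiplication by $r^q$, and for an ideal $I$ of $R$ let $I^{[q]}$ be the ideal generated by $\{a^q : a\in I\}$. Let $\psi: k\to E=E_R(k)$ be the embedding of the residue field in its injective hull, let $K_e$ be the image of $1\otimes\psi: R^{(e)}\otimes_R k\to R^{(e)}\otimes_R E$, and define the $e$-th normalized Frobenius splitting number of $R$ by $$ s_e(R)=\frac{\lambda_{R^{(e)}}(K_e)}{q^{d}}, $$ where $\lambda$ denotes length. Let $\boldsymbol x=x_1,\dots,x_d$ be any system of parameters of $R$ (with $(\boldsymbol x)=0$ if $d=0$), and let $u\in R$ be any element whose image in $R/(\boldsymbol x)$ generates the socle $\{y\in R/(\boldsymbol x) : \mathfrak m y=0\}$. Then, for every $e\ge 0$, the length on the right-hand side below is finite and $$ s_e(R)\cdot q^d=\lambda_R\!\left(\frac{Ru^q+(\boldsymbol x)^{[q]}}{(\boldsymbol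 x)^{[q]}}\right). $$ -/

import Mathlib

open scoped TensorProduct ENNReal

universe u

namespace FrobeniusSplitting

/-- A (Noetherian) local ring is Gorenstein if it has finite injective dimension as a module
over itself. -/
def IsGorensteinLocalRing (R : Type u) [CommRing R] : Prop :=
  IsNoetherianRing R ∧ IsLocalRing R ∧
    ∃ n : ℕ, CategoryTheory.HasInjectiveDimensionLE (ModuleCat.of R R) n

/-- `x₁, …, x_d` is a system of parameters of the local ring `R`: `d` is the Krull dimension
of `R` and the ideal `(x₁, …, x_d)` is primary to the maximal ideal. -/
def IsSystemOfParameters {R : Type u} [CommRing R] [IsLocalRing R] {d : ℕ}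
    (x : Fin d → R) : Prop :=
  ringKrullDim R = d ∧ (Ideal.span (Set.range x)).radical = IsLocalRing.maximalIdeal R

/-- The socle `{y ∈ M : 𝔪 y = 0}` of a module over a local ring `(R, 𝔪)`. -/
def socle (R : Type u) [CommRing R] [IsLocalRing R] (M : Type u) [AddCommGroup M] [Module R M] :
    Submodule R M :=
  Submodule.torsionBySet R M (IsLocalRing.maximalIdeal R : Set R)

/-- For `q = p ^ e`, this is `I^{[q]}`: the ideal generated by the `q`-th powers of the elements
of `I`. -/
def frobeniusPower {R : Type u} [CommRing R] (I : Ideal R) (q : ℕ) : Ideal R :=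
  Ideal.span ((fun a : R => a ^ q) '' (I : Set R))

/-- The map `ψ : M → E` is an injective hull of `M`: `E` is an injective module, `ψ` is injective
and `E` is an essential extension of the image of `ψ`. -/
structure IsInjectiveHull {R : Type u} [CommRing R] {M E : Type u} [AddCommGroup M] [Module R M]
    [AddCommGroup E] [Module R E] (ψ : M →ₗ[R] E) : Prop where
  injective_module : Module.Injective R E
  injective_map : Function.Injective ψ
  essential : ∀ N : Submodule R E, N ⊓ LinearMap.range ψ = ⊥ → N = ⊥

/-- Every module has an injective hull. -/
theorem exists_isInjectiveHull (R : Type u) [CommRing R] (M : Type u) [AddCommGroup M]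
    [Module R M] : ∃ (E : ModuleCat.{u} R) (ψ : M →ₗ[R] E), IsInjectiveHull ψ := by
  classical
  let Q : ModuleCat.{u} R := CategoryTheory.Injective.under (ModuleCat.of R M)
  let i : M →ₗ[R] Q := (CategoryTheory.Injective.ι (ModuleCat.of R M)).hom
  have hi : Function.Injective i :=
    (ModuleCat.mono_iff_injective (CategoryTheory.Injective.ι (ModuleCat.of R M))).1 inferInstance
  have hQ : Module.Injective R Q := by
    have : CategoryTheory.Injective (ModuleCat.of R Q) :=
      inferInstanceAs (CategoryTheory.Injective (CategoryTheory.Injective.under (ModuleCat.of R M)))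
    exact Module.injective_module_of_injective_object R Q
  let N := LinearMap.range i
  -- a maximal essential extension of `N` in `Q`
  let S : Set (Submodule R Q) := {E | N ≤ E ∧ ∀ L, L ≤ E → L ⊓ N = ⊥ → L = ⊥}
  obtain ⟨E, -, hE⟩ : ∃ E, N ≤ E ∧ Maximal (· ∈ S) E := by
    refine zorn_le_nonempty₀ S ?_ N ⟨le_rfl, fun L hL h => by rwa [inf_eq_left.2 hL] at h⟩
    intro c hc hchain y hy
    refine ⟨sSup c, ⟨(hc hy).1.trans (le_sSup hy), ?_⟩, fun z hz => le_sSup hz⟩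
    intro L hL h
    rw [eq_bot_iff]
    intro a ha
    obtain ⟨F, hF, haF⟩ := (Submodule.mem_sSup_of_directed ⟨y, hy⟩ hchain.directedOn).1 (hL ha)
    have : L ⊓ F = ⊥ := (hc hF).2 _ inf_le_right
      (eq_bot_iff.2 (h ▸ inf_le_inf_right _ inf_le_left))
    exact this ▸ ⟨ha, haF⟩
  -- a maximal submodule of `Q` meeting `E` trivially
  obtain ⟨C, -, hC⟩ : ∃ C, ⊥ ≤ C ∧ Maximal (· ∈ {C : Submodule R Q | C ⊓ E = ⊥}) C := by
    refine zorn_le_nonempty₀ _ ?_ ⊥ (by simp)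
    intro c hc hchain y hy
    refine ⟨sSup c, ?_, fun z hz => le_sSup hz⟩
    change sSup c ⊓ E = ⊥
    rw [eq_bot_iff]
    rintro a ⟨ha, haE⟩
    obtain ⟨F, hF, haF⟩ := (Submodule.mem_sSup_of_directed ⟨y, hy⟩ hchain.directedOn).1 ha
    exact (hc hF : F ⊓ E = ⊥) ▸ ⟨haF, haE⟩
  have hCE : C ⊓ E = ⊥ := hC.prop
  let g : E →ₗ[R] (Q ⧸ C) := C.mkQ ∘ₗ E.subtype
  have hg : Function.Injective g := by
    rw [← LinearMap.ker_eq_bot, eq_bot_iff]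
    intro a ha
    have h1 : (a : Q) ∈ C := by simpa [g] using ha
    have h2 : (a : Q) ∈ C ⊓ E := ⟨h1, a.2⟩
    rw [hCE] at h2
    simpa using h2
  obtain ⟨h, hh⟩ := hQ.out g hg E.subtype
  -- `h` is injective, as `Q ⧸ C` is essential over `E`
  have hker : LinearMap.ker h = ⊥ := by
    have h1 : C ≤ (LinearMap.ker h).comap C.mkQ := fun a ha => by
      have : C.mkQ a = 0 := by simpa using ha
      simp [this]
    have h2 : (LinearMap.ker h).comap C.mkQ ⊓ E = ⊥ := by
      rw [eq_bot_iff]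
      rintro a ⟨ha, haE⟩
      have := hh ⟨a, haE⟩
      have h3 : h (C.mkQ a) = 0 := ha
      have h4 : h (C.mkQ a) = a := this
      rw [h3] at h4
      exact h4.symm
    have h3 := hC.le_of_ge h2 h1
    rw [eq_bot_iff]
    intro b hb
    obtain ⟨a, rfl⟩ := C.mkQ_surjective b
    have : a ∈ C := h3 hb
    simpa using this
  have hEr : E ≤ LinearMap.range h := fun a ha => ⟨g ⟨a, ha⟩, hh ⟨a, ha⟩⟩
  have hr : LinearMap.range h ∈ S := by
    refine ⟨hE.prop.1.trans hEr, fun L hL hLN => ?_⟩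
    -- `L ⊓ E = ⊥` since `E` is essential over `N`
    have h1 : L ⊓ E = ⊥ := hE.prop.2 _ inf_le_right
      (eq_bot_iff.2 (hLN ▸ inf_le_inf_right _ inf_le_left))
    let D : Submodule R Q := (L.comap h).comap C.mkQ
    have h2 : D ⊓ E = ⊥ := by
      rw [eq_bot_iff]
      rintro a ⟨ha, haE⟩
      have h4 : h (C.mkQ a) = a := hh ⟨a, haE⟩
      have h3 : h (C.mkQ a) ∈ L := ha
      rw [h4] at h3
      exact h1 ▸ ⟨h3, haE⟩
    have h1' : C ≤ D := fun a ha => by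
      have : C.mkQ a = 0 := by simpa using ha
      simp [D, this]
    have h3 := hC.le_of_ge h2 h1'
    rw [eq_bot_iff]
    intro b hb
    obtain ⟨c, rfl⟩ := hL hb
    obtain ⟨a, rfl⟩ := C.mkQ_surjective c
    have : a ∈ C := h3 hb
    have : C.mkQ a = 0 := by simpa using this
    simp [this]
  have hrE : LinearMap.range h ≤ E := hE.le_of_ge hr hEr
  -- hence `E` is a retract of `Q`
  let r : Q →ₗ[R] E := (h ∘ₗ C.mkQ).codRestrict E fun a => hrE ⟨C.mkQ a, rfl⟩
  have hrr : ∀ a : E, r a = a := fun a => Subtype.ext (hh a)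
  let ψ : M →ₗ[R] E := i.codRestrict E fun m => hE.prop.1 ⟨m, rfl⟩
  refine ⟨ModuleCat.of R E, ψ, ⟨⟨?_⟩, ?_, ?_⟩⟩
  · intro X Y _ _ _ _ f hf k
    obtain ⟨l, hl⟩ := hQ.out f hf (E.subtype ∘ₗ k)
    exact ⟨r ∘ₗ l, fun a => by rw [LinearMap.comp_apply, hl]; exact hrr (k a)⟩
  · intro a b hab
    exact hi (congrArg Subtype.val hab)
  · intro L hL
    have h1 : L.map E.subtype ⊓ N = ⊥ := by
      rw [eq_bot_iff]
      rintro _ ⟨⟨a, ha, rfl⟩, ⟨m, hm⟩⟩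
      have h2 : a ∈ L ⊓ LinearMap.range ψ := ⟨ha, m, Subtype.ext hm⟩
      have h3 : a ∈ (⊥ : Submodule R E) := hL ▸ h2
      have h4 : a = 0 := h3
      simp [h4]
    have h2 := hE.prop.2 _ (Submodule.map_subtype_le E L) h1
    rw [eq_bot_iff]
    intro a ha
    have h3 : (a : Q) ∈ L.map E.subtype := ⟨a, ha, rfl⟩
    rw [h2] at h3
    exact Subtype.ext h3

/-- The injective hull `E_R(k)` of the residue field `k` of a local ring `R`. -/
noncomputable def residueHull (R : Type u) [CommRing R] [IsLocalRing R] : ModuleCat.{u} R :=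
  (exists_isInjectiveHull R (IsLocalRing.ResidueField R)).choose

/-- The embedding `ψ : k → E_R(k)` of the residue field in its injective hull. -/
noncomputable def residueHullMap (R : Type u) [CommRing R] [IsLocalRing R] :
    IsLocalRing.ResidueField R →ₗ[R] residueHull R :=
  (exists_isInjectiveHull R (IsLocalRing.ResidueField R)).choose_spec.choose

theorem residueHullMap_isInjectiveHull (R : Type u) [CommRing R] [IsLocalRing R] :
    IsInjectiveHull (residueHullMap R) :=
  (exists_isInjectiveHull R (IsLocalRing.ResidueField R)).choose_spec.choose_spec

/-- The `R`-algebra `R^{(e)}`: as a ring it is `R`, and `r ∈ R` acts as multiplication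
by `r ^ (p ^ e)`. -/
def FrobeniusAlgebra (R : Type u) (_p _e : ℕ) : Type u := R

instance (R : Type u) [CommRing R] (p e : ℕ) : CommRing (FrobeniusAlgebra R p e) :=
  inferInstanceAs (CommRing R)

noncomputable instance (R : Type u) [CommRing R] (p e : ℕ) [ExpChar R p] :
    Algebra R (FrobeniusAlgebra R p e) :=
  RingHom.toAlgebra (S := FrobeniusAlgebra R p e) (iterateFrobenius R p e)

/-- `K_e`, the image of `1 ⊗ ψ : R^{(e)} ⊗ k → R^{(e)} ⊗ E_R(k)`, as an `R^{(e)}`-module. -/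
noncomputable def splittingModule (R : Type u) [CommRing R] [IsLocalRing R] (p e : ℕ)
    [ExpChar R p] :
    Submodule (FrobeniusAlgebra R p e) (FrobeniusAlgebra R p e ⊗[R] residueHull R) :=
  LinearMap.range ((residueHullMap R).baseChange (FrobeniusAlgebra R p e))

/-- The `e`-th normalized Frobenius splitting number `s_e(R) = λ(K_e) / q ^ dim R`, `q = p ^ e`,
with values in `[0, ∞]`, so that no junk value can occur for the length. -/
noncomputable def normalizedSplittingNumber (R : Type u) [CommRing R] [IsLocalRing R] (p e : ℕ)
    [ExpChar R p] : ℝ≥0∞ :=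
  ((Module.length (FrobeniusAlgebra R p e) (splittingModule R p e) : ℕ∞) : ℝ≥0∞) /
    ((p : ℝ≥0∞) ^ e) ^ ((ringKrullDim R).unbotD 0).toNat

end FrobeniusSplitting

open FrobeniusSplitting

/-!
Both lengths are lengths of cyclic modules, so the identity is one of annihilators. The module
`K_e` is generated by `1 ⊗ ψ(1)`, and `(R v ^ q + (x)^{[q]}) / (x)^{[q]}` is `R` modulo the colon
ideal `(x)^{[q]} : v ^ q`. Hence it suffices that, for `a ∈ R`, the tensor `a ⊗ ψ(1)` vanishes in
`R^{(e)} ⊗ E` if and only if `a v ^ q ∈ (x)^{[q]}` (`IsParameterFamily.tmul_eq_zero_iff`).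

Both directions compare `E` with quotients of `R` by parameter ideals, through the isomorphism of
`R^{(e)} ⊗ R ⧸ I` with `R ⧸ I^{[q]}` (`tmul_mk_eq_zero_iff`). Since `E` is injective, there is a map
`R ⧸ (x) → E` taking the socle generator `v` to `ψ(1)`; it gives one direction. For the other, a
vanishing tensor already vanishes over a finite submodule `N` of `E`, and `ψ(1)` survives in
`N / (x ^ (t + 1)) N` for some `t` by Krull's intersection theorem. As `R ⧸ (x ^ (t + 1))` is
self-injective, there is a map `N → R ⧸ (x ^ (t + 1))` taking `ψ(1)` to `v ∏ x ^ t`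
(`IsParameterFamily.exists_linearMap_quotient_pow`). So `a v ^ q ∏ x ^ (q t)` lies in the ideal
`(x ^ (q (t + 1)))`, and `a v ^ q` lies in `(x ^ q)` because parameters form a regular sequence
(`IsParameterFamily.mem_span_of_mul_prod_pow_mem`).

What remains is to extract two facts from finite injective dimension: parameters form regular
sequences, and the quotient by them is self-injective. Finite injective dimension passes to the
quotient by a nonzerodivisor (`hasInjectiveDimensionLE_quotient`). In depth zero it forces the ring
to be self-injective, since the top `Ext` into `R` vanishes by Nakayama's lemma on `R ⧸ 𝔭` for
`𝔭 ≠ 𝔪`, and on the residue field because the latter embeds in `R`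
(`hasInjectiveDimensionLE_of_succ`); the ring then has dimension zero. An induction on the
dimension shows that `dim R ⧸ 𝔭 ≥ dim R` for every associated prime `𝔭`
(`IsGorensteinLocalRing.le_ringKrullDim_quotient`), so parameters avoid the associated primes.
-/

namespace FrobeniusSplitting

/-! ### Injective dimension modulo a regular element -/

section InjectiveDimension

open CategoryTheory

variable {R : Type u} [CommRing R]

theorem injective_iff_hasInjectiveDimensionLE_zero (M : Type u) [AddCommGroup M] [Module R M] :
    Module.Injective R M ↔ HasInjectiveDimensionLE (ModuleCat.of R M) 0 := by
  rw [Module.injective_iff_injective_object]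
  exact injective_iff_hasInjectiveDimensionLT_one

variable {M I N : Type u} [AddCommGroup M] [Module R M] [AddCommGroup I] [Module R I]
  [AddCommGroup N] [Module R N]

theorem shortExact_of_linearMap {f : M →ₗ[R] I} {g : I →ₗ[R] N} (hf : Function.Injective f)
    (hfg : Function.Exact f g) (hg : Function.Surjective g) :
    (ModuleCat.shortComplexOfCompEqZero f g hfg.linearMap_comp_eq_zero).ShortExact :=
  ModuleCat.shortComplex_shortExact _ hfg hf hg

theorem hasInjectiveDimensionLE_succ_iff {f : M →ₗ[R] I} {g : I →ₗ[R] N}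
    (hf : Function.Injective f) (hfg : Function.Exact f g) (hg : Function.Surjective g)
    (hI : Module.Injective R I) (n : ℕ) :
    HasInjectiveDimensionLE (ModuleCat.of R M) (n + 1) ↔
      HasInjectiveDimensionLE (ModuleCat.of R N) n :=
  ((shortExact_of_linearMap hf hfg hg).hasInjectiveDimensionLT_X₃_iff n
    ((Module.injective_iff_injective_object R I).1 hI)).symm

theorem exists_injective_extension (M : Type u) [AddCommGroup M] [Module R M] :
    ∃ (I : ModuleCat.{u} R) (f : M →ₗ[R] I), Module.Injective R I ∧ Function.Injective f := by
  obtain ⟨E, ψ, h⟩ := exists_isInjectiveHull R M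
  exact ⟨E, ψ, h.injective_module, h.injective_map⟩

theorem hasInjectiveDimensionLE_of_leftInverse (i : M →ₗ[R] N) (r : N →ₗ[R] M)
    (h : Function.LeftInverse r i) {n : ℕ}
    (hN : HasInjectiveDimensionLE (ModuleCat.of R N) n) :
    HasInjectiveDimensionLE (ModuleCat.of R M) n :=
  Retract.hasInjectiveDimensionLT (Y := ModuleCat.of R N)
    { i := ModuleCat.ofHom i
      r := ModuleCat.ofHom r
      retract := ModuleCat.hom_ext (LinearMap.ext h) } (n + 1)

/-- The map induced by `f : M → N` on the submodules of elements killed by `y`, as a map of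
modules over `R ⧸ (y)`. -/
noncomputable def torsionByMap (y : R) (f : M →ₗ[R] N) :
    Submodule.torsionBy R M y →ₗ[R ⧸ Ideal.span {y}] Submodule.torsionBy R N y :=
  LinearMap.extendScalarsOfSurjective Ideal.Quotient.mk_surjective
    (f.restrict (p := Submodule.torsionBy R M y) (q := Submodule.torsionBy R N y)
      fun m hm => by
        rw [Submodule.mem_torsionBy_iff] at hm ⊢
        rw [← map_smul, hm, map_zero])

theorem injective_torsionBy (y : R) (hI : Module.Injective R I) :
    Module.Injective (R ⧸ Ideal.span {y}) (Submodule.torsionBy R I y) := by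
  refine ⟨fun X Y _ _ _ _ f hf g => ?_⟩
  let _ : Module R X := Module.compHom X (Ideal.Quotient.mk (Ideal.span {y}))
  let _ : Module R Y := Module.compHom Y (Ideal.Quotient.mk (Ideal.span {y}))
  have : IsScalarTower R (R ⧸ Ideal.span {y}) X := ⟨fun a b c => by
    rw [Algebra.smul_def, mul_smul]; rfl⟩
  have : IsScalarTower R (R ⧸ Ideal.span {y}) Y := ⟨fun a b c => by
    rw [Algebra.smul_def, mul_smul]; rfl⟩
  obtain ⟨h, hh⟩ := hI.out (f.restrictScalars R) hf
    ((Submodule.torsionBy R I y).subtype ∘ₗ g.restrictScalars R)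
  have hy : ∀ b : Y, y • b = 0 := fun b => by
    have : (Ideal.Quotient.mk (Ideal.span {y}) y) • b = 0 := by
      rw [Ideal.Quotient.eq_zero_iff_mem.2 (Ideal.mem_span_singleton_self y), zero_smul]
    exact this
  let h' : Y →ₗ[R] Submodule.torsionBy R I y := h.codRestrict _ fun b => by
    rw [Submodule.mem_torsionBy_iff, ← map_smul, hy, map_zero]
  exact ⟨LinearMap.extendScalarsOfSurjective Ideal.Quotient.mk_surjective h',
    fun a => Subtype.ext (hh a)⟩

/-- An injective module is divisible by every nonzerodivisor of the ring. -/
theorem exists_smul_eq_of_injective {y : R} (hy : y ∈ nonZeroDivisors R)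
    (hI : Module.Injective R I) (a : I) : ∃ b : I, y • b = a := by
  obtain ⟨h, hh⟩ := hI.out (LinearMap.mulLeft R y)
    (fun b c hbc => (mul_cancel_left_mem_nonZeroDivisors hy).1 hbc)
    (LinearMap.toSpanSingleton R I a)
  refine ⟨h 1, ?_⟩
  have := hh 1
  simpa [← map_smul] using this

/-- On a module that is divisible by `y`, passing to the elements killed by `y` is exact, so it
turns an injective resolution over `R` into one over `R ⧸ (y)`. -/
theorem hasInjectiveDimensionLE_torsionBy {y : R} (hy : y ∈ nonZeroDivisors R) (n : ℕ) :
    ∀ (M : Type u) [AddCommGroup M] [Module R M], (∀ a : M, ∃ b : M, y • b = a) →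
      HasInjectiveDimensionLE (ModuleCat.of R M) n →
      HasInjectiveDimensionLE
        (ModuleCat.of (R ⧸ Ideal.span {y}) (Submodule.torsionBy R M y)) n := by
  induction n with
  | zero =>
    intro M _ _ _ h
    rw [← injective_iff_hasInjectiveDimensionLE_zero] at h ⊢
    exact injective_torsionBy y h
  | succ n ih =>
    intro M _ _ hdiv h
    obtain ⟨I, f, hI, hf⟩ := exists_injective_extension (R := R) M
    have hfg := f.exact_map_mkQ_range
    have hg := Submodule.mkQ_surjective (LinearMap.range f)
    rw [hasInjectiveDimensionLE_succ_iff hf hfg hg hI] at h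
    refine (hasInjectiveDimensionLE_succ_iff (f := torsionByMap y f)
      (g := torsionByMap y (LinearMap.range f).mkQ) ?_ ?_ ?_
      (injective_torsionBy y hI) n).2 (ih _ ?_ h)
    · intro a b hab
      exact Subtype.ext (hf (congrArg Subtype.val hab))
    · intro a
      constructor
      · intro ha
        obtain ⟨m, hm⟩ := (hfg a).1 (congrArg Subtype.val ha)
        refine ⟨⟨m, (Submodule.mem_torsionBy_iff _ _).2 (hf ?_)⟩, Subtype.ext hm⟩
        rw [map_smul, hm, map_zero]
        exact (Submodule.mem_torsionBy_iff _ _).1 a.2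
      · rintro ⟨m, rfl⟩
        exact Subtype.ext ((hfg _).2 ⟨_, rfl⟩)
    · rintro ⟨b, hb⟩
      obtain ⟨a, rfl⟩ := hg b
      rw [Submodule.mem_torsionBy_iff, ← map_smul] at hb
      obtain ⟨m, hm⟩ := (hfg _).1 hb
      obtain ⟨m', rfl⟩ := hdiv m
      refine ⟨⟨a - f m', ?_⟩, Subtype.ext ?_⟩
      · rw [Submodule.mem_torsionBy_iff, smul_sub, ← map_smul, hm, sub_self]
      · change (LinearMap.range f).mkQ (a - f m') = (LinearMap.range f).mkQ a
        rw [map_sub, (hfg _).2 ⟨m', rfl⟩, sub_zero]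
    · intro b
      obtain ⟨a, rfl⟩ := hg b
      obtain ⟨c, rfl⟩ := exists_smul_eq_of_injective hy hI a
      exact ⟨(LinearMap.range f).mkQ c, (map_smul _ _ _).symm⟩

/-- If `0 → R → I → N → 0` is exact with `I` injective, then the snake lemma for multiplication
by `y` gives an exact sequence `0 → I[y] → N[y] → R ⧸ (y) → 0` of `R ⧸ (y)`-modules, as `y` is
regular on `R` and `I` is divisible by `y`. It splits, the class of `1` lifting to the image in
`N` of an element `c` of `I` with `y c = 1`. -/
theorem hasInjectiveDimensionLE_quotient {y : R} (hy : y ∈ nonZeroDivisors R) (n : ℕ)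
    (h : HasInjectiveDimensionLE (ModuleCat.of R R) (n + 1)) :
    HasInjectiveDimensionLE
      (ModuleCat.of (R ⧸ Ideal.span {y}) (R ⧸ Ideal.span {y})) n := by
  obtain ⟨I, f, hI, hf⟩ := exists_injective_extension (R := R) R
  have hfg := f.exact_map_mkQ_range
  have hg := Submodule.mkQ_surjective (LinearMap.range f)
  rw [hasInjectiveDimensionLE_succ_iff hf hfg hg hI] at h
  set g := (LinearMap.range f).mkQ
  have hdivI := exists_smul_eq_of_injective hy hI
  have hN := hasInjectiveDimensionLE_torsionBy hy n _ (fun b => by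
    obtain ⟨a, rfl⟩ := hg b
    obtain ⟨c, rfl⟩ := hdivI a
    exact ⟨g c, (map_smul _ _ _).symm⟩) h
  obtain ⟨c, hc⟩ := hdivI (f 1)
  let w : Submodule.torsionBy R (I ⧸ LinearMap.range f) y := ⟨g c, by
    rw [Submodule.mem_torsionBy_iff, ← map_smul, hc]
    exact (hfg _).2 ⟨1, rfl⟩⟩
  -- `N[y]` is generated by the image of `I[y]` and `w`: if `y a = f r`, then `a - r c ∈ I[y]`
  have key : ∀ b : Submodule.torsionBy R (I ⧸ LinearMap.range f) y,
      ∃ (r : R) (a : Submodule.torsionBy R I y), b = torsionByMap y g a +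
        (Ideal.Quotient.mk (Ideal.span {y}) r) • w := by
    rintro ⟨b, hb⟩
    obtain ⟨a, rfl⟩ := hg b
    rw [Submodule.mem_torsionBy_iff, ← map_smul] at hb
    obtain ⟨r, hr⟩ := (hfg _).1 hb
    have hr' : f r = y • r • c := by
      rw [smul_comm, hc, ← map_smul, smul_eq_mul, mul_one]
    refine ⟨r, ⟨a - r • c, ?_⟩, Subtype.ext ?_⟩
    · rw [Submodule.mem_torsionBy_iff, smul_sub, ← hr, hr', sub_self]
    · change g a = g (a - r • c) + r • g c
      rw [map_sub, map_smul, sub_add_cancel]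
  -- a multiple of `w` in the image of `I[y]` is zero
  have hker : ∀ (r : R) (a : Submodule.torsionBy R I y), torsionByMap y g a +
        (Ideal.Quotient.mk (Ideal.span {y}) r) • w = 0 → r ∈ Ideal.span {y} := by
    intro r a h0
    have h1 : g (a + r • c) = 0 := by
      rw [map_add, map_smul]
      exact congrArg Subtype.val h0
    obtain ⟨s, hs⟩ := (hfg _).1 h1
    have h2 : f (y • s) = f r := by
      rw [map_smul, hs, smul_add, (Submodule.mem_torsionBy_iff _ _).1 a.2, zero_add, smul_comm, hc,
        ← map_smul, smul_eq_mul, mul_one]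
    rw [← hf h2]
    exact Ideal.mul_mem_right _ _ (Ideal.mem_span_singleton_self y)
  -- `N[y]` is the direct sum of the image of `I[y]` and the line through `w`
  have hsurj : Function.Surjective
      ((torsionByMap y g).coprod (LinearMap.toSpanSingleton (R ⧸ Ideal.span {y}) _ w)) := by
    intro b
    obtain ⟨r, a, h⟩ := key b
    exact ⟨(a, Ideal.Quotient.mk _ r), h.symm⟩
  have hginj : ∀ a : Submodule.torsionBy R I y, torsionByMap y g a = 0 → a = 0 := by
    intro a ha
    obtain ⟨s, hs⟩ := (hfg (a : I)).1 (congrArg Subtype.val ha)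
    have h2 : f (y • s) = f 0 := by
      rw [map_smul, hs, (Submodule.mem_torsionBy_iff _ _).1 a.2, map_zero]
    have h3 : s = 0 := by
      have := hf h2
      rw [smul_eq_mul] at this
      exact (mul_left_mem_nonZeroDivisors_eq_zero_iff hy).1 this
    apply Subtype.ext
    rw [← hs, h3, map_zero]
    rfl
  have hinj : Function.Injective
      ((torsionByMap y g).coprod (LinearMap.toSpanSingleton (R ⧸ Ideal.span {y}) _ w)) := by
    rw [← LinearMap.ker_eq_bot, LinearMap.ker_eq_bot']
    rintro ⟨a, r⟩ h0
    obtain ⟨r, rfl⟩ := Ideal.Quotient.mk_surjective r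
    have h0' : torsionByMap y g a + (Ideal.Quotient.mk (Ideal.span {y}) r) • w = 0 := h0
    have hr := Ideal.Quotient.eq_zero_iff_mem.2 (hker r a h0')
    rw [hr, zero_smul, add_zero] at h0'
    rw [hr, hginj a h0']
    rfl
  let e := LinearEquiv.ofBijective _ ⟨hinj, hsurj⟩
  -- hence `R ⧸ (y)` is a retract of `N[y]`
  refine hasInjectiveDimensionLE_of_leftInverse (e.toLinearMap ∘ₗ LinearMap.inr _ _ _)
    (LinearMap.snd _ _ _ ∘ₗ e.symm.toLinearMap) (fun r => ?_) hN
  rw [LinearMap.comp_apply, LinearMap.comp_apply]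
  erw [e.symm_apply_apply]
  rfl

end InjectiveDimension

end FrobeniusSplitting

namespace FrobeniusSplitting

/-! ### Finite injective dimension in depth zero -/

section DepthZero

open CategoryTheory Abelian

variable {R : Type u} [CommRing R]

/-- Baer's criterion in degree `n`: the injective dimension is tested by finite modules. -/
theorem hasInjectiveDimensionLE_of_finite (n : ℕ) :
    ∀ (X : Type u) [AddCommGroup X] [Module R X],
      (∀ (M : Type u) [AddCommGroup M] [Module R M] [Module.Finite R M],
        Subsingleton (Ext (ModuleCat.of R M) (ModuleCat.of R X) (n + 1))) →
      HasInjectiveDimensionLE (ModuleCat.of R X) n := by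
  induction n with
  | zero =>
    intro X _ _ h
    rw [← injective_iff_hasInjectiveDimensionLE_zero]
    refine Module.Baer.injective fun I g => ?_
    have hS := shortExact_of_linearMap (Submodule.injective_subtype I)
      (LinearMap.exact_subtype_mkQ I) (Submodule.mkQ_surjective I)
    have := h (R ⧸ I)
    obtain ⟨φ, hφ⟩ := Ext.contravariant_sequence_exact₁ hS (ModuleCat.of R X)
      (Ext.mk₀ (ModuleCat.ofHom g)) (zero_add 1) (Subsingleton.elim _ _)
    obtain ⟨φ, rfl⟩ := Ext.homEquiv₀.symm.surjective φ
    have h1 : (ModuleCat.ofHom I.subtype) ≫ φ = ModuleCat.ofHom g :=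
      Ext.homEquiv₀.symm.injective (by simpa using hφ)
    exact ⟨φ.hom, fun a ha => LinearMap.congr_fun (congrArg ModuleCat.Hom.hom h1) ⟨a, ha⟩⟩
  | succ n ih =>
    intro X _ _ h
    obtain ⟨I, f, hI, hf⟩ := exists_injective_extension (R := R) X
    have hfg := f.exact_map_mkQ_range
    have hg := Submodule.mkQ_surjective (LinearMap.range f)
    rw [hasInjectiveDimensionLE_succ_iff hf hfg hg hI]
    refine ih _ fun M _ _ _ => subsingleton_of_forall_eq 0 fun a => ?_
    have hS := shortExact_of_linearMap hf hfg hg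
    have := h M
    have : Injective (ModuleCat.of R I) := (Module.injective_iff_injective_object R I).1 hI
    obtain ⟨b, rfl⟩ := Ext.covariant_sequence_exact₃ (ModuleCat.of R M) hS a rfl
      (Subsingleton.elim _ _)
    have hb : b = 0 := Ext.eq_zero_of_injective (I := ModuleCat.of R I) b
    rw [hb, Ext.zero_comp]

variable [IsLocalRing R]

theorem exists_isSMulRegular_quotient {P : Ideal R} (hp : P.IsPrime)
    (hP : P ≠ IsLocalRing.maximalIdeal R) :
    ∃ y ∈ IsLocalRing.maximalIdeal R, IsSMulRegular (R ⧸ P) y := by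
  obtain ⟨y, hym, hyP⟩ : ∃ y ∈ IsLocalRing.maximalIdeal R, y ∉ P := by
    by_contra! hc
    exact hP (le_antisymm (IsLocalRing.le_maximalIdeal hp.ne_top) hc)
  exact ⟨y, hym, (isSMulRegular_quotient_iff_mem_of_smul_mem _ _).2 fun a ha =>
    (hp.mem_or_mem ha).resolve_left hyP⟩

variable [IsNoetherianRing R]

/-- If `y ∈ 𝔪` is regular on `N`, then it acts surjectively on the top `Ext (N, R)`, which
therefore vanishes by Nakayama's lemma. -/
theorem subsingleton_ext_of_isSMulRegular {n : ℕ}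
    (h : HasInjectiveDimensionLE (ModuleCat.of R R) n) (N : Type u) [AddCommGroup N] [Module R N]
    [Module.Finite R N] {y : R} (hym : y ∈ IsLocalRing.maximalIdeal R) (hy : IsSMulRegular N y) :
    Subsingleton (Ext (ModuleCat.of R N) (ModuleCat.of R R) n) := by
  let f : N →ₗ[R] N := y • LinearMap.id
  have hf : Function.Injective f := hy
  have hS := shortExact_of_linearMap hf f.exact_map_mkQ_range
    (Submodule.mkQ_surjective (LinearMap.range f))
  have hsurj : ∀ a : Ext (ModuleCat.of R N) (ModuleCat.of R R) n,
      ∃ b : Ext (ModuleCat.of R N) (ModuleCat.of R R) n, y • b = a := by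
    intro a
    obtain ⟨b, hb⟩ := Ext.contravariant_sequence_exact₁ hS (ModuleCat.of R R) a (add_comm 1 n)
      (Ext.eq_zero_of_hasInjectiveDimensionLT _ (n + 1) le_rfl)
    refine ⟨b, ?_⟩
    rw [← hb]
    have : (ModuleCat.shortComplexOfCompEqZero f (LinearMap.range f).mkQ
      f.exact_map_mkQ_range.linearMap_comp_eq_zero).f = y • 𝟙 (ModuleCat.of R N) := rfl
    rw [this, Ext.mk₀_smul, Ext.smul_comp, Ext.mk₀_id_comp]
  have := Submodule.eq_bot_of_le_smul_of_le_jacobson_bot (IsLocalRing.maximalIdeal R)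
    (⊤ : Submodule R (Ext (ModuleCat.of R N) (ModuleCat.of R R) n))
    Module.Finite.fg_top (fun a _ => by
      obtain ⟨b, rfl⟩ := hsurj a
      exact Submodule.smul_mem_smul hym trivial)
    (IsLocalRing.maximalIdeal_le_jacobson _)
  exact subsingleton_of_forall_eq 0 fun a => (Submodule.mem_bot R).1 (this ▸ trivial)

/-- In depth zero the residue field embeds in `R`, so `Ext (k, R)` vanishes in the top degree,
being a quotient of `Ext (R, R)`. -/
theorem hasInjectiveDimensionLE_of_succ
    (hm : IsLocalRing.maximalIdeal R ∈ associatedPrimes R R) {n : ℕ}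
    (h : HasInjectiveDimensionLE (ModuleCat.of R R) (n + 1)) :
    HasInjectiveDimensionLE (ModuleCat.of R R) n := by
  refine hasInjectiveDimensionLE_of_finite n R fun M _ _ _ => ?_
  induction ‹Module.Finite R M› using
    IsNoetherianRing.induction_on_isQuotientEquivQuotientPrime R with
  | subsingleton N =>
    refine subsingleton_of_forall_eq 0 fun a => ?_
    have : Projective (ModuleCat.of R N) :=
      (IsProjective.iff_projective N).1 inferInstance
    exact Ext.eq_zero_of_projective a
  | quotient N P e =>
    by_cases hP : P.1 = IsLocalRing.maximalIdeal R
    · obtain ⟨-, f, hf⟩ := (isAssociatedPrime_iff_exists_injective_linearMap P.1 R).1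
        (AssociatedPrimes.mem_iff.1 (hP ▸ hm))
      have hS := shortExact_of_linearMap (f := f ∘ₗ e.toLinearMap)
        (hf.comp e.injective) (LinearMap.exact_map_mkQ_range _) (Submodule.mkQ_surjective _)
      refine subsingleton_of_forall_eq 0 fun a => ?_
      have : Projective (ModuleCat.of R R) :=
        (IsProjective.iff_projective R).1 inferInstance
      obtain ⟨b, rfl⟩ := Ext.contravariant_sequence_exact₁ hS (ModuleCat.of R R) a
        (add_comm 1 (n + 1)) (Ext.eq_zero_of_hasInjectiveDimensionLT _ (n + 2) le_rfl)
      have hb : b = 0 := Ext.eq_zero_of_projective (P := ModuleCat.of R R) b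
      rw [hb, Ext.comp_zero]
    · obtain ⟨y, hym, hy⟩ := exists_isSMulRegular_quotient P.2 hP
      exact subsingleton_ext_of_isSMulRegular h N hym ((e.isSMulRegular_congr y).2 hy)
  | exact N₁ N₂ N₃ f g hf hg hfg h₁ h₃ =>
    refine subsingleton_of_forall_eq 0 fun a => ?_
    have hS := shortExact_of_linearMap hf hfg hg
    obtain ⟨b, rfl⟩ := Ext.contravariant_sequence_exact₂ hS (ModuleCat.of R R) a
      (Subsingleton.elim (h := h₁) _ _)
    have hb : b = 0 := Subsingleton.elim (h := h₃) _ _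
    rw [hb, Ext.comp_zero]

/-- A local ring of depth zero and finite injective dimension is self-injective. -/
theorem injective_of_maximalIdeal_mem_associatedPrimes
    (hm : IsLocalRing.maximalIdeal R ∈ associatedPrimes R R) {n : ℕ}
    (h : HasInjectiveDimensionLE (ModuleCat.of R R) n) : Module.Injective R R := by
  induction n with
  | zero => exact (injective_iff_hasInjectiveDimensionLE_zero R).2 h
  | succ n ih => exact ih (hasInjectiveDimensionLE_of_succ hm h)

/-- For `𝔭 ≠ 𝔪`, an element `y ∈ 𝔪 \ 𝔭` acts surjectively on `Hom (R ⧸ 𝔭, R)`, the annihilator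
of `𝔭`. -/
theorem eq_maximalIdeal_of_mem_associatedPrimes (h : Module.Injective R R) {P : Ideal R}
    (hP : P ∈ associatedPrimes R R) : P = IsLocalRing.maximalIdeal R := by
  by_contra hne
  have hp : P.IsPrime := hP.1
  obtain ⟨-, φ, hφ⟩ := (isAssociatedPrime_iff_exists_injective_linearMap P R).1
    (AssociatedPrimes.mem_iff.1 hP)
  obtain ⟨y, hym, hy⟩ := exists_isSMulRegular_quotient hp hne
  let f : (R ⧸ P) →ₗ[R] (R ⧸ P) := y • LinearMap.id
  have hf : Function.Injective f := hy
  have := Submodule.eq_bot_of_le_smul_of_le_jacobson_bot (IsLocalRing.maximalIdeal R)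
    (⊤ : Submodule R ((R ⧸ P) →ₗ[R] R))
    Module.Finite.fg_top (fun a _ => by
      obtain ⟨b, hb⟩ := h.out f hf a
      have : a = y • b := LinearMap.ext fun c => by
        rw [← hb c]
        exact map_smul b y c
      rw [this]
      exact Submodule.smul_mem_smul hym trivial)
    (IsLocalRing.maximalIdeal_le_jacobson _)
  have h0 : φ = 0 := (Submodule.mem_bot R).1 (this ▸ trivial)
  have h1 : (1 : R ⧸ P) = 0 := hφ (by rw [h0]; rfl)
  exact one_ne_zero h1

end DepthZero

end FrobeniusSplitting

namespace FrobeniusSplitting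

/-! ### Systems of parameters of a Gorenstein local ring -/

section Parameters

theorem comap_mk_maximalIdeal {R : Type u} [CommRing R] [IsLocalRing R] (I : Ideal R)
    [IsLocalRing (R ⧸ I)] :
    (IsLocalRing.maximalIdeal (R ⧸ I)).comap (Ideal.Quotient.mk I) = IsLocalRing.maximalIdeal R :=
  IsLocalRing.eq_maximalIdeal
    (Ideal.comap_isMaximal_of_surjective _ Ideal.Quotient.mk_surjective)

theorem IsGorensteinLocalRing.quotient_span_singleton {R : Type u} [CommRing R] [IsLocalRing R]
    (hR : IsGorensteinLocalRing R) {y : R} (hym : y ∈ IsLocalRing.maximalIdeal R)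
    (hy : y ∈ nonZeroDivisors R) : IsGorensteinLocalRing (R ⧸ Ideal.span {y}) := by
  obtain ⟨_, _, n, hn⟩ := hR
  have : Nontrivial (R ⧸ Ideal.span {y}) := Ideal.Quotient.nontrivial_iff.2
    (ne_top_of_le_ne_top (IsLocalRing.maximalIdeal.isMaximal R).ne_top
      ((Ideal.span_singleton_le_iff_mem _).2 hym))
  exact ⟨inferInstance, IsLocalRing.of_surjective' _ Ideal.Quotient.mk_surjective, n,
    hasInjectiveDimensionLE_quotient hy n
      (CategoryTheory.hasInjectiveDimensionLT_of_ge _ (n + 1) (n + 2) (Nat.le_succ _))⟩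

theorem exists_mem_nonZeroDivisors {R : Type u} [CommRing R] [IsLocalRing R] [IsNoetherianRing R]
    (h : IsLocalRing.maximalIdeal R ∉ associatedPrimes R R) :
    ∃ y ∈ IsLocalRing.maximalIdeal R, y ∈ nonZeroDivisors R := by
  by_contra! hc
  refine h ?_
  obtain ⟨P, hP, hle⟩ := (Ideal.subset_union_prime_finite (associatedPrimes.finite R R)
    (f := id) (I := IsLocalRing.maximalIdeal R) 0 0 fun _ h _ _ => h.1).1 (by
      simp_rw [id, biUnion_associatedPrimes_eq_compl_nonZeroDivisors]
      exact hc)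
  rwa [(IsLocalRing.maximalIdeal.isMaximal R).eq_of_le hP.1.ne_top hle]

/-- A Gorenstein local ring of depth zero has dimension zero. -/
theorem IsGorensteinLocalRing.ringKrullDim_eq_zero {R : Type u} [CommRing R] [IsLocalRing R]
    (hR : IsGorensteinLocalRing R) (hm : IsLocalRing.maximalIdeal R ∈ associatedPrimes R R) :
    ringKrullDim R = 0 := by
  obtain ⟨_, _, n, hn⟩ := hR
  have hinj := injective_of_maximalIdeal_mem_associatedPrimes hm hn
  have : Ring.KrullDimLE 0 R := Ring.krullDimLE_zero_iff.2 fun P hP => by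
    obtain ⟨Q, hQ, hQP⟩ := Ideal.exists_minimalPrimes_le (bot_le : ⊥ ≤ P)
    have hQ' : Q ∈ associatedPrimes R R :=
      Module.associatedPrimes.minimalPrimes_annihilator_subset_associatedPrimes R R (by
        rwa [Module.annihilator_eq_bot.2 inferInstance])
    rw [eq_maximalIdeal_of_mem_associatedPrimes hinj hQ'] at hQP
    rw [← (IsLocalRing.maximalIdeal.isMaximal R).eq_of_le hP.ne_top hQP]
    infer_instance
  exact le_antisymm (Order.krullDimLE_iff _ _|>.1 this) ringKrullDim_nonneg_of_nontrivial

/-- Every associated prime of a Gorenstein local ring has coheight the dimension of the ring.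
By induction on the dimension, modulo a nonzerodivisor `y`: an element with annihilator `P` can
be divided by a power of `y` until it is nonzero modulo `y`, so that `P + (y)` lies in an
associated prime of `R ⧸ (y)`. -/
theorem IsGorensteinLocalRing.le_ringKrullDim_quotient (d : ℕ) :
    ∀ {R : Type u} [CommRing R], IsGorensteinLocalRing R → ringKrullDim R = d →
      ∀ P ∈ associatedPrimes R R, (d : WithBot ℕ∞) ≤ ringKrullDim (R ⧸ P) := by
  induction d with
  | zero =>
    intro R _ hR hd P hP
    have := Ideal.Quotient.nontrivial_iff.2 hP.1.ne_top
    exact ringKrullDim_nonneg_of_nontrivial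
  | succ d ih =>
    intro R _ hR hd P hP
    have hR' := hR
    obtain ⟨_, _, -⟩ := hR'
    have hm : IsLocalRing.maximalIdeal R ∉ associatedPrimes R R := fun hm => by
      rw [hR.ringKrullDim_eq_zero hm] at hd
      exact absurd hd.symm (by exact_mod_cast Nat.succ_ne_zero d)
    obtain ⟨y, hym, hy⟩ := exists_mem_nonZeroDivisors hm
    have hRy := hR.quotient_span_singleton hym hy
    have hdy : ringKrullDim (R ⧸ Ideal.span {y}) = d := by
      have h := ringKrullDim_quotient_span_singleton_succ_eq_ringKrullDim_of_mem_nonZeroDivisors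
        hy hym
      rw [hd] at h
      exact ENat.WithBot.add_one_cancel.1 h
    obtain ⟨hp, z, hz⟩ := isAssociatedPrime_iff.1 (AssociatedPrimes.mem_iff.1 hP)
    have hzP : ∀ a, a ∈ P ↔ a * z = 0 := fun a => by
      rw [hz, Submodule.mem_colon_singleton, Submodule.mem_bot, smul_eq_mul]
    have hz0 : z ≠ 0 := fun h0 => hp.ne_top <| (Ideal.eq_top_iff_one P).2 <|
      (hzP 1).2 (by rw [h0, mul_zero])
    have hfin : FiniteMultiplicity y z := by
      by_contra hc
      refine hz0 ((Submodule.mem_bot R).1 ?_)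
      rw [← Ideal.iInf_pow_eq_bot_of_isLocalRing (Ideal.span {y})
        (fun h => Ideal.span_singleton_ne_top
          (fun hu => (IsLocalRing.mem_maximalIdeal y).1 hym hu) h), Ideal.mem_iInf]
      intro i
      rw [Ideal.span_singleton_pow, Ideal.mem_span_singleton]
      exact FiniteMultiplicity.not_iff_forall.1 hc i
    -- `z'` is the quotient of `z` by the largest power of `y` that divides it
    obtain ⟨z', hz', hyz'⟩ := hfin.exists_eq_pow_mul_and_not_dvd
    have hz'0 : Ideal.Quotient.mk (Ideal.span {y}) z' ≠ 0 := fun h => hyz' <|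
      Ideal.mem_span_singleton.1 (Ideal.Quotient.eq_zero_iff_mem.1 h)
    have := hRy.1
    obtain ⟨Q, hQ, hle⟩ := exists_le_isAssociatedPrime_of_isNoetherianRing
      (R ⧸ Ideal.span {y}) _ hz'0
    have hPQ : ∀ a ∈ P, Ideal.Quotient.mk (Ideal.span {y}) a ∈ Q := by
      intro a ha
      refine hle (Submodule.mem_colon_singleton.2 ((Submodule.mem_bot _).2 ?_))
      have h1 : y ^ multiplicity y z * (a * z') = 0 := by
        rw [mul_left_comm, ← hz']
        exact (hzP a).1 ha
      have h2 := (mul_left_mem_nonZeroDivisors_eq_zero_iff (pow_mem hy _)).1 h1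
      rw [smul_eq_mul, ← map_mul, h2, map_zero]
    let φ : R ⧸ P →+* (R ⧸ Ideal.span {y}) ⧸ Q := Ideal.Quotient.lift P
      ((Ideal.Quotient.mk Q).comp (Ideal.Quotient.mk (Ideal.span {y})))
      fun a ha => Ideal.Quotient.eq_zero_iff_mem.2 (hPQ a ha)
    have hφ : Function.Surjective φ := Ideal.Quotient.lift_surjective_of_surjective _ _
      (Ideal.Quotient.mk_surjective.comp Ideal.Quotient.mk_surjective)
    have hyP : Ideal.Quotient.mk P y ∈ nonZeroDivisors (R ⧸ P) := by
      rw [mem_nonZeroDivisors_iff_ne_zero, Ne, Ideal.Quotient.eq_zero_iff_mem, hzP,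
        mul_left_mem_nonZeroDivisors_eq_zero_iff hy]
      exact hz0
    have h := ringKrullDim_succ_le_of_surjective φ hφ hyP (by
      change Ideal.Quotient.mk Q (Ideal.Quotient.mk (Ideal.span {y}) y) = 0
      rw [Ideal.Quotient.eq_zero_iff_mem.2 (Ideal.mem_span_singleton_self y), map_zero])
    push_cast
    exact (add_le_add_left (ih hRy hdy Q hQ) 1).trans h

variable {ι : Type*}

/-- The elements `x i`, for `i ∈ s`, form a system of parameters of the local ring `R`: their
number is the dimension of `R`, and the maximal ideal is the only prime ideal containing them. -/
def IsParameterFamily {R : Type u} [CommRing R] [IsLocalRing R] (x : ι → R) (s : Finset ι) :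
    Prop :=
  ringKrullDim R = s.card ∧ (∀ i ∈ s, x i ∈ IsLocalRing.maximalIdeal R) ∧
    ∀ P : Ideal R, P.IsPrime → (∀ i ∈ s, x i ∈ P) → P = IsLocalRing.maximalIdeal R

theorem IsSystemOfParameters.isParameterFamily {R : Type u} [CommRing R] [IsLocalRing R] {d : ℕ}
    {x : Fin d → R} (hx : IsSystemOfParameters x) : IsParameterFamily x Finset.univ := by
  refine ⟨by simpa using hx.1, fun i _ => ?_, fun P hP h => ?_⟩
  · rw [← hx.2]
    exact Ideal.le_radical (Ideal.subset_span ⟨i, rfl⟩)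
  · refine le_antisymm (IsLocalRing.le_maximalIdeal hP.ne_top) ?_
    rw [← hx.2, hP.radical_le_iff, Ideal.span_le]
    rintro _ ⟨i, rfl⟩
    exact h i (Finset.mem_univ i)

/-- The system remains one when its members are raised to positive powers. -/
theorem IsParameterFamily.of_pow {R : Type u} [CommRing R] [IsLocalRing R] {x z : ι → R}
    {s : Finset ι} (hx : IsParameterFamily x s) (hz : ∀ i ∈ s, ∃ n ≠ 0, z i = x i ^ n) :
    IsParameterFamily z s := by
  refine ⟨hx.1, fun i hi => ?_, fun P hP h => hx.2.2 P hP fun i hi => ?_⟩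
  · obtain ⟨n, hn, h⟩ := hz i hi
    rw [h]
    exact Ideal.pow_mem_of_mem _ (hx.2.1 i hi) n (Nat.pos_of_ne_zero hn)
  · obtain ⟨n, -, hn⟩ := hz i hi
    exact hP.mem_of_pow_mem n (hn ▸ h i hi)

variable [DecidableEq ι]

/-- A member of a system of parameters in an associated prime `P` would leave fewer than
`dim R ⧸ P` parameters for `R ⧸ P`. -/
theorem IsParameterFamily.mem_nonZeroDivisors {R : Type u} [CommRing R] [IsLocalRing R]
    (hR : IsGorensteinLocalRing R) {x : ι → R} {s : Finset ι} (hx : IsParameterFamily x s)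
    {i : ι} (hi : i ∈ s) : x i ∈ nonZeroDivisors R := by
  have := hR.1
  by_contra hc
  have h : x i ∈ ⋃ p ∈ associatedPrimes R R, (p : Set R) := by
    rw [biUnion_associatedPrimes_eq_compl_nonZeroDivisors]
    exact hc
  simp only [Set.mem_iUnion] at h
  obtain ⟨P, hP, hiP⟩ := h
  have hdim := hR.le_ringKrullDim_quotient _ hx.1 P hP
  have : Nontrivial (R ⧸ P) := Ideal.Quotient.nontrivial_iff.2 hP.1.ne_top
  have : IsLocalRing (R ⧸ P) := IsLocalRing.of_surjective' _ Ideal.Quotient.mk_surjective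
  classical
  let T : Finset (R ⧸ P) := (s.erase i).image fun j => Ideal.Quotient.mk P (x j)
  have hmax : ∀ Q : Ideal (R ⧸ P), Q.IsPrime → (T : Set (R ⧸ P)) ⊆ Q →
      Q.comap (Ideal.Quotient.mk P) = IsLocalRing.maximalIdeal R := fun Q hQ hTQ =>
    hx.2.2 _ (hQ.comap _) fun j hj => by
      by_cases hij : j = i
      · rw [hij, Ideal.mem_comap, Ideal.Quotient.eq_zero_iff_mem.2 hiP]
        exact Q.zero_mem
      · exact hTQ (Finset.mem_image.2 ⟨j, Finset.mem_erase.2 ⟨hij, hj⟩, rfl⟩)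
  have h0 : Ring.KrullDimLE 0 ((R ⧸ P) ⧸ Ideal.span (T : Set (R ⧸ P))) := by
    refine Ring.krullDimLE_zero_iff.2 fun Q hQ => ?_
    have h1 := hmax (Q.comap (Ideal.Quotient.mk _)) (hQ.comap _) fun t ht => by
      rw [SetLike.mem_coe, Ideal.mem_comap,
        Ideal.Quotient.eq_zero_iff_mem.2 (Ideal.subset_span ht)]
      exact Q.zero_mem
    rw [Ideal.comap_comap] at h1
    have h2 : (Q.comap ((Ideal.Quotient.mk (Ideal.span (T : Set (R ⧸ P)))).comp
        (Ideal.Quotient.mk P))).IsMaximal := h1 ▸ inferInstance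
    have hsurj : Function.Surjective ((Ideal.Quotient.mk (Ideal.span (T : Set (R ⧸ P)))).comp
        (Ideal.Quotient.mk P)) :=
      Ideal.Quotient.mk_surjective.comp Ideal.Quotient.mk_surjective
    have h3 := Ideal.map_eq_top_or_isMaximal_of_surjective _ hsurj h2
    rw [Ideal.map_comap_of_surjective _ hsurj] at h3
    exact h3.resolve_left hQ.ne_top
  have hT : (T : Set (R ⧸ P)) ⊆ IsLocalRing.maximalIdeal (R ⧸ P) := by
    intro t ht
    obtain ⟨j, hj, rfl⟩ := Finset.mem_image.1 ht
    rw [SetLike.mem_coe, ← Ideal.mem_comap, comap_mk_maximalIdeal]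
    exact hx.2.1 j (Finset.mem_of_mem_erase hj)
  have h1 : (s.card : WithBot ℕ∞) ≤ ((s.erase i).card : ℕ) := calc
    (s.card : WithBot ℕ∞) ≤ ringKrullDim (R ⧸ P) := hdim
    _ ≤ _ := ringKrullDim_le_ringKrullDim_quotient_add_card T
      (by rwa [IsLocalRing.ringJacobson_eq_maximalIdeal])
    _ ≤ 0 + T.card := add_le_add_left ((Order.krullDimLE_iff _ _).1 h0) _
    _ ≤ ((s.erase i).card : ℕ) := by
      rw [zero_add]
      exact_mod_cast Finset.card_image_le
  exact absurd (Finset.card_erase_lt_of_mem hi) (not_lt.2 (by exact_mod_cast h1))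

theorem IsParameterFamily.quotient {R : Type u} [CommRing R] [IsLocalRing R]
    {x : ι → R} {s : Finset ι} (hx : IsParameterFamily x s)
    {i : ι} (hi : i ∈ s) (hreg : x i ∈ nonZeroDivisors R) [IsNoetherianRing R]
    [IsLocalRing (R ⧸ Ideal.span {x i})] :
    IsParameterFamily (fun j => Ideal.Quotient.mk (Ideal.span {x i}) (x j)) (s.erase i) := by
  have hsurj := Ideal.Quotient.mk_surjective (I := Ideal.span {x i})
  have hcomap : (IsLocalRing.maximalIdeal (R ⧸ Ideal.span {x i})).comap (Ideal.Quotient.mk _) =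
      IsLocalRing.maximalIdeal R := comap_mk_maximalIdeal _
  refine ⟨?_, fun j hj => ?_, fun P hP h => ?_⟩
  · have h := ringKrullDim_quotient_span_singleton_succ_eq_ringKrullDim_of_mem_nonZeroDivisors
      hreg (hx.2.1 i hi)
    rw [hx.1, ← Finset.card_erase_add_one hi] at h
    exact ENat.WithBot.add_one_cancel.1 h
  · rw [← Ideal.mem_comap, hcomap]
    exact hx.2.1 j (Finset.mem_of_mem_erase hj)
  · refine Ideal.comap_injective_of_surjective _ hsurj ?_
    rw [hcomap]
    refine hx.2.2 _ (hP.comap _) fun j hj => ?_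
    by_cases hij : j = i
    · rw [hij, Ideal.mem_comap,
        Ideal.Quotient.eq_zero_iff_mem.2 (Ideal.mem_span_singleton_self _)]
      exact P.zero_mem
    · exact h j (Finset.mem_erase.2 ⟨hij, hj⟩)

/-- The members of a system of parameters form a regular sequence in any order. -/
theorem IsParameterFamily.mem_span_of_mul_mem (n : ℕ) : ∀ {R : Type u} [CommRing R]
    [IsLocalRing R], IsGorensteinLocalRing R → ∀ {x : ι → R} {s : Finset ι}, s.card = n →
    IsParameterFamily x s → ∀ {j : ι}, j ∈ s → ∀ {a : R},
      a * x j ∈ Ideal.span (x '' (s.erase j)) → a ∈ Ideal.span (x '' (s.erase j)) := by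
  induction n with
  | zero =>
    intro R _ _ _ x s hs _ j hj
    rw [Finset.card_eq_zero.1 hs] at hj
    exact absurd hj (Finset.notMem_empty j)
  | succ n ih =>
    intro R _ _ hR x s hs hx j hj a ha
    have := hR.1
    -- divide by another parameter `x i`, until `x j` is the only one left
    by_cases hne : (s.erase j).Nonempty
    · obtain ⟨i, hij⟩ := hne
      have hi := Finset.mem_of_mem_erase hij
      have hreg := hx.mem_nonZeroDivisors hR hi
      have hR' := hR.quotient_span_singleton (hx.2.1 i hi) hreg
      have := hR'.2.1
      have hx' := hx.quotient hi hreg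
      have himage : Ideal.span ((fun j => Ideal.Quotient.mk (Ideal.span {x i}) (x j)) ''
          ((s.erase i).erase j)) =
          (Ideal.span (x '' ((s.erase i).erase j))).map (Ideal.Quotient.mk (Ideal.span {x i})) := by
        rw [Ideal.map_span, Set.image_image]
      have hspan : Ideal.span (x '' (s.erase j)) =
          Ideal.span (x '' ((s.erase i).erase j)) ⊔ Ideal.span {x i} := by
        rw [← Ideal.span_union, Finset.erase_right_comm, Set.union_comm, ← Set.insert_eq,
          ← Set.image_insert_eq, ← Finset.coe_insert, Finset.insert_erase hij]
      have hmem : ∀ b, b ∈ Ideal.span (x '' (s.erase j)) ↔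
          Ideal.Quotient.mk (Ideal.span {x i}) b ∈
            Ideal.span ((fun j => Ideal.Quotient.mk (Ideal.span {x i}) (x j)) ''
              ((s.erase i).erase j)) := fun b => by
        rw [himage, hspan, Ideal.mem_quotient_iff_mem_sup]
      rw [hmem] at ha ⊢
      rw [map_mul] at ha
      exact ih hR' (by rw [Finset.card_erase_of_mem hi, hs, Nat.add_sub_cancel]) hx'
        (Finset.mem_erase.2 ⟨(Finset.ne_of_mem_erase hij).symm, hj⟩) ha
    · rw [Finset.not_nonempty_iff_eq_empty] at hne
      rw [hne] at ha ⊢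
      simp only [Finset.coe_empty, Set.image_empty, Ideal.span_empty, Ideal.mem_bot] at ha ⊢
      exact (mul_right_mem_nonZeroDivisors_eq_zero_iff (hx.mem_nonZeroDivisors hR hj)).1 ha

/-- The quotient of a Gorenstein local ring by a system of parameters is self-injective. -/
theorem IsParameterFamily.injective_of_ker_eq (n : ℕ) : ∀ {R : Type u} [CommRing R]
    [IsLocalRing R], IsGorensteinLocalRing R → ∀ {x : ι → R} {s : Finset ι}, s.card = n →
    IsParameterFamily x s → ∀ {S : Type u} [CommRing S] (φ : R →+* S), Function.Surjective φ →
      RingHom.ker φ = Ideal.span (x '' s) → Module.Injective S S := by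
  induction n with
  | zero =>
    intro R _ _ hR x s hs hx S _ φ hφ hker
    obtain ⟨_, _, n, hn⟩ := hR
    rw [Finset.card_eq_zero.1 hs] at hker hx
    simp only [Finset.coe_empty, Set.image_empty, Ideal.span_empty] at hker
    obtain ⟨P, hP⟩ := associatedPrimes.nonempty R R
    have hPm := hx.2.2 P hP.1 (by simp)
    have hinj := injective_of_maximalIdeal_mem_associatedPrimes (hPm ▸ hP) hn
    let e := RingEquiv.ofBijective φ ⟨(RingHom.injective_iff_ker_eq_bot φ).2 hker, hφ⟩
    have := RingHomInvPair.of_ringEquiv e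
    have := RingHomInvPair.of_ringEquiv e.symm
    exact Module.Injective.of_ringEquiv (M := R) e
      { e with
        map_smul' := fun a b => map_mul e a b }
  | succ n ih =>
    intro R _ _ hR x s hs hx S _ φ hφ hker
    have := hR.1
    obtain ⟨i, hi⟩ : s.Nonempty := Finset.card_pos.1 (by lia)
    have hreg := hx.mem_nonZeroDivisors hR hi
    have hR' := hR.quotient_span_singleton (hx.2.1 i hi) hreg
    have := hR'.2.1
    have hx' := hx.quotient hi hreg
    have hle : Ideal.span {x i} ≤ RingHom.ker φ := by
      rw [hker, Ideal.span_singleton_le_iff_mem]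
      exact Ideal.subset_span ⟨i, hi, rfl⟩
    refine ih hR' (by rw [Finset.card_erase_of_mem hi, hs, Nat.add_sub_cancel]) hx'
      (Ideal.Quotient.lift _ φ hle) (Ideal.Quotient.lift_surjective_of_surjective _ _ hφ) ?_
    have herase : (s : Set ι) = insert i ↑(s.erase i) := by
      rw [← Finset.coe_insert, Finset.insert_erase hi]
    rw [Ideal.ker_quotient_lift, hker, Ideal.map_span, herase, Set.image_insert_eq,
      Set.image_insert_eq, Ideal.span_insert, Set.image_image,
      Ideal.Quotient.eq_zero_iff_mem.2 (Ideal.mem_span_singleton_self _),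
      Ideal.span_singleton_zero, bot_sup_eq]

/-- Exponents of a system of parameters can be lowered from `t + 1` to `1`, on the subset `T`, by
dividing by `t`-th powers. -/
theorem IsParameterFamily.mem_span_of_mul_prod_pow_mem {R : Type u} [CommRing R] [IsLocalRing R]
    (hR : IsGorensteinLocalRing R) {y : ι → R} {s : Finset ι} (hy : IsParameterFamily y s)
    (t : ℕ) {a : R} (T : Finset ι) (hT : T ⊆ s)
    (ha : a * ∏ i ∈ T, y i ^ t ∈
      Ideal.span ((fun i => if i ∈ T then y i ^ (t + 1) else y i) '' s)) :
    a ∈ Ideal.span (y '' s) := by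
  induction T using Finset.induction_on with
  | empty => simpa using ha
  | insert j T hj ih =>
    refine ih ((Finset.subset_insert j T).trans hT) ?_
    have hjs : j ∈ s := hT (Finset.mem_insert_self j T)
    set z : ι → R := fun i => if i ∈ T then y i ^ (t + 1) else y i with hz
    set b := a * ∏ i ∈ T, y i ^ t with hb
    have hzj : z j = y j := if_neg hj
    have hzs : IsParameterFamily z s := hy.of_pow fun i _ => by
      by_cases hi : i ∈ T
      · exact ⟨t + 1, Nat.succ_ne_zero t, if_pos hi⟩
      · exact ⟨1, one_ne_zero, by rw [pow_one]; exact if_neg hi⟩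
    have hsplit : ∀ w : ι → R, Ideal.span (w '' s) =
        Ideal.span {w j} ⊔ Ideal.span (w '' (s.erase j)) := fun w => by
      rw [← Ideal.span_union, ← Set.insert_eq, ← Set.image_insert_eq, ← Finset.coe_insert,
        Finset.insert_erase hjs]
    have herase : (fun i => if i ∈ insert j T then y i ^ (t + 1) else y i) '' (s.erase j) =
        z '' (s.erase j) := Set.image_congr fun i hi => by
      have hij : i ≠ j := Finset.ne_of_mem_erase hi
      simp [hz, Finset.mem_insert, hij]
    rw [hsplit, herase, Submodule.mem_sup] at ha
    obtain ⟨c, hc, e, he, hce⟩ := ha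
    rw [if_pos (Finset.mem_insert_self j T)] at hc
    obtain ⟨c, rfl⟩ := Ideal.mem_span_singleton'.1 hc
    -- `z` agrees with the given family off `j` and is `y j` at `j`, so `y j` is regular modulo the
    -- other members of the given family
    have hpow : ∀ (m : ℕ) (r : R), r * z j ^ m ∈ Ideal.span (z '' (s.erase j)) →
        r ∈ Ideal.span (z '' (s.erase j)) := by
      intro m
      induction m with
      | zero => intro r hr; simpa using hr
      | succ m ihm =>
        intro r hr
        rw [pow_succ, ← mul_assoc] at hr
        exact ihm r (hzs.mem_span_of_mul_mem _ hR rfl hjs hr)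
    have h1 : b - c * y j ∈ Ideal.span (z '' (s.erase j)) := by
      refine hpow t _ ?_
      have : (b - c * y j) * z j ^ t = e := by
        rw [Finset.prod_insert hj] at hce
        rw [hzj, hb]
        linear_combination (-1 : R) * hce
      rwa [this]
    rw [hsplit, hzj, Submodule.mem_sup]
    exact ⟨c * y j, Ideal.mem_span_singleton'.2 ⟨c, rfl⟩, _, h1, add_sub_cancel _ _⟩

end Parameters

end FrobeniusSplitting

namespace FrobeniusSplitting

/-! ### Frobenius powers and the socle modulo parameters -/

section Frobenius

theorem frobeniusPower_eq_map {R : Type u} [CommRing R] (I : Ideal R) (p e : ℕ) [ExpChar R p] :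
    frobeniusPower I (p ^ e) = I.map (iterateFrobenius R p e) := rfl

theorem frobeniusPower_span_image {R : Type u} [CommRing R] {ι : Type*} (x : ι → R) (s : Set ι)
    (p e : ℕ) [ExpChar R p] :
    frobeniusPower (Ideal.span (x '' s)) (p ^ e) = Ideal.span ((fun i => x i ^ p ^ e) '' s) := by
  rw [frobeniusPower_eq_map, Ideal.map_span, Set.image_image]
  rfl

/-- `R^{(e)} ⊗ R ⧸ I` is `R ⧸ I^{[q]}`, the class of `r` acting on `R^{(e)}` as `r ^ q`. -/
theorem tmul_mk_eq_zero_iff {R : Type u} [CommRing R] (I : Ideal R) (p e : ℕ) [ExpChar R p]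
    (a r : R) :
    (show FrobeniusAlgebra R p e from a) ⊗ₜ[R] Ideal.Quotient.mk I r = 0 ↔
      a * r ^ p ^ e ∈ frobeniusPower I (p ^ e) := by
  rw [← (TensorProduct.tensorQuotEquivQuotSMul (FrobeniusAlgebra R p e) I).map_eq_zero_iff,
    TensorProduct.tensorQuotEquivQuotSMul_tmul_mk, Submodule.Quotient.mk_eq_zero,
    Ideal.smul_top_eq_map, Submodule.restrictScalars_mem, Algebra.smul_def, mul_comm]
  exact Iff.rfl

/-- A vector `w` can be sent to `z` in an injective module as soon as `z` is killed by the
annihilator of `w`. -/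
theorem exists_linearMap_apply_eq {S : Type u} [CommRing S] {N Q : Type u} [AddCommGroup N]
    [Module S N] [AddCommGroup Q] [Module S Q] (hQ : Module.Injective S Q) (w : N) (z : Q)
    (h : ∀ r : S, r • w = 0 → r • z = 0) : ∃ f : N →ₗ[S] Q, f w = z := by
  let K := LinearMap.ker (LinearMap.toSpanSingleton S N w)
  let i : (S ⧸ K) →ₗ[S] N := K.liftQ (LinearMap.toSpanSingleton S N w) le_rfl
  have hi : Function.Injective i := LinearMap.ker_eq_bot.1 (Submodule.ker_liftQ_eq_bot _ _ _ le_rfl)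
  obtain ⟨f, hf⟩ := hQ.out i hi (K.liftQ (LinearMap.toSpanSingleton S Q z) h)
  refine ⟨f, ?_⟩
  have h1 : f ((1 : S) • w) = (1 : S) • z := hf (K.mkQ 1)
  rwa [one_smul, one_smul] at h1

/-- A pure tensor that vanishes already vanishes over a finite submodule. -/
theorem exists_finite_submodule_tmul_eq_zero {R : Type u} [CommRing R] {A E : Type*}
    [AddCommGroup A] [Module R A] [AddCommGroup E] [Module R E] {a : A} {w : E}
    (h : a ⊗ₜ[R] w = 0) :
    ∃ (N : Submodule R E) (hw : w ∈ N), N.FG ∧ a ⊗ₜ[R] (⟨w, hw⟩ : N) = 0 := by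
  have hw := Submodule.mem_span_singleton_self (R := R) w
  obtain ⟨N, hN, hle, heq⟩ := Submodule.FG.exists_rTensor_fg_inclusion_eq
    (M := A) (Submodule.fg_span_singleton w)
    (x := (⟨w, hw⟩ : Submodule.span R {w}) ⊗ₜ[R] a) (y := 0) (by
      rw [LinearMap.rTensor_tmul, map_zero]
      have := congrArg (TensorProduct.comm R A E) h
      rwa [TensorProduct.comm_tmul, map_zero] at this)
  refine ⟨N, hle hw, hN, ?_⟩
  rw [LinearMap.rTensor_tmul, map_zero] at heq
  have := congrArg (TensorProduct.comm R N A) heq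
  rwa [TensorProduct.comm_tmul, map_zero] at this

variable {ι : Type*} {R : Type u} [CommRing R] [IsLocalRing R]

/-- An ideal generated by a system of parameters has finite colength. -/
theorem IsParameterFamily.length_ne_top [IsNoetherianRing R] {x : ι → R} {s : Finset ι}
    (hx : IsParameterFamily x s) : Module.length R (R ⧸ Ideal.span (x '' s)) ≠ ⊤ := by
  have : Ring.KrullDimLE 0 (R ⧸ Ideal.span (x '' s)) := Ring.krullDimLE_zero_iff.2 fun Q hQ => by
    have h : Q.comap (Ideal.Quotient.mk (Ideal.span (x '' s))) = IsLocalRing.maximalIdeal R :=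
      hx.2.2 _ (hQ.comap _) fun i hi => by
        have hi' : x i ∈ Ideal.span (x '' s) := Ideal.subset_span ⟨i, hi, rfl⟩
        rw [Ideal.mem_comap, Ideal.Quotient.eq_zero_iff_mem.2 hi']
        exact Q.zero_mem
    have h2 : (Q.comap (Ideal.Quotient.mk (Ideal.span (x '' s)))).IsMaximal := h ▸ inferInstance
    have hsurj := Ideal.Quotient.mk_surjective (I := Ideal.span (x '' s))
    have h3 := Ideal.map_eq_top_or_isMaximal_of_surjective _ hsurj h2
    rw [Ideal.map_comap_of_surjective _ hsurj] at h3
    exact h3.resolve_left hQ.ne_top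
  have : IsArtinianRing (R ⧸ Ideal.span (x '' s)) :=
    isArtinianRing_iff_krullDimLE_zero.2 this
  have : IsArtinian R (R ⧸ Ideal.span (x '' s)) :=
    isArtinian_of_surjective_algebraMap (R := R ⧸ Ideal.span (x '' s))
      Ideal.Quotient.mk_surjective
  exact Module.length_ne_top

/-- The annihilator of a generator of the socle modulo a system of parameters is the maximal
ideal, since that socle is nonzero. -/
theorem IsParameterFamily.mul_mem_iff [IsNoetherianRing R] {x : ι → R} {s : Finset ι}
    (hx : IsParameterFamily x s) {v : R}
    (hv : Submodule.span R {Ideal.Quotient.mk (Ideal.span (x '' s)) v} =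
      socle R (R ⧸ Ideal.span (x '' s))) (r : R) :
    r * v ∈ Ideal.span (x '' s) ↔ r ∈ IsLocalRing.maximalIdeal R := by
  set I := Ideal.span (x '' s) with hI
  have hIm : I ≤ IsLocalRing.maximalIdeal R := Ideal.span_le.2 (by
    rintro _ ⟨i, hi, rfl⟩
    exact hx.2.1 i hi)
  have hmv : ∀ r ∈ IsLocalRing.maximalIdeal R, r * v ∈ I := fun r hr => by
    have h1 : Ideal.Quotient.mk I v ∈ socle R (R ⧸ I) := hv ▸ Submodule.mem_span_singleton_self _
    exact Ideal.Quotient.eq_zero_iff_mem.1 ((Submodule.mem_torsionBySet_iff _ _).1 h1 ⟨r, hr⟩)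
  have hvI : v ∉ I := fun hvI => by
    have : Nontrivial (R ⧸ I) := Ideal.Quotient.nontrivial_iff.2
      (ne_top_of_le_ne_top (IsLocalRing.maximalIdeal.isMaximal R).ne_top hIm)
    obtain ⟨P, hP⟩ := associatedPrimes.nonempty R (R ⧸ I)
    have hPm : P = IsLocalRing.maximalIdeal R := hx.2.2 P hP.1 fun i hi => by
      refine hP.annihilator_le ?_
      rw [Submodule.annihilator_top, Ideal.annihilator_quotient]
      exact Ideal.subset_span ⟨i, hi, rfl⟩
    obtain ⟨hp, z, hz⟩ := isAssociatedPrime_iff.1 (AssociatedPrimes.mem_iff.1 hP)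
    have hzs : z ∈ socle R (R ⧸ I) := (Submodule.mem_torsionBySet_iff _ _).2 fun a => by
      have : (a : R) ∈ P := hPm ▸ a.2
      rw [hz, Submodule.mem_colon_singleton, Submodule.mem_bot] at this
      exact this
    rw [← hv, Ideal.Quotient.eq_zero_iff_mem.2 hvI, Submodule.span_zero_singleton,
      Submodule.mem_bot] at hzs
    refine hp.ne_top ((Ideal.eq_top_iff_one P).2 ?_)
    rw [hz, Submodule.mem_colon_singleton, hzs, smul_zero]
    exact zero_mem _
  refine ⟨fun h => ?_, hmv r⟩
  by_contra hr
  rw [IsLocalRing.mem_maximalIdeal, mem_nonunits_iff, not_not] at hr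
  exact hvI ((Ideal.unit_mul_mem_iff_mem I hr).1 h)

/-! ### The annihilator of the splitting module -/

variable [DecidableEq ι]

/-- Let `w` be a nonzero vector killed by `𝔪` in a finite module `N`, and `v` a generator of the
socle modulo parameters `x`. By Krull's intersection theorem `w` survives modulo `(x ^ (t + 1))`
for some `t`, and self-injectivity of `R ⧸ (x ^ (t + 1))` provides a map that takes `w` to the
socle element `v ∏ x ^ t` there. -/
theorem IsParameterFamily.exists_linearMap_quotient_pow (hR : IsGorensteinLocalRing R)
    {x : ι → R} {s : Finset ι} (hx : IsParameterFamily x s) {v : R}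
    (hv : ∀ r ∈ IsLocalRing.maximalIdeal R, r * v ∈ Ideal.span (x '' s))
    {N : Type u} [AddCommGroup N] [Module R N] [Module.Finite R N] {w : N} (hw : w ≠ 0) :
    ∃ (t : ℕ) (θ : N →ₗ[R] R ⧸ Ideal.span ((fun i => x i ^ (t + 1)) '' (s : Set ι))),
      θ w = Ideal.Quotient.mk _ (v * ∏ i ∈ s, x i ^ t) := by
  have := hR.1
  obtain ⟨t, ht⟩ : ∃ t : ℕ, w ∉ IsLocalRing.maximalIdeal R ^ t • (⊤ : Submodule R N) := by
    by_contra! hc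
    refine hw ((Submodule.mem_bot R).1 ?_)
    rw [← Ideal.iInf_pow_smul_eq_bot_of_isLocalRing (IsLocalRing.maximalIdeal R)
      (IsLocalRing.maximalIdeal.isMaximal R).ne_top, Submodule.mem_iInf]
    exact hc
  refine ⟨t, ?_⟩
  set J := Ideal.span ((fun i => x i ^ (t + 1)) '' (s : Set ι)) with hJ
  have hJm : J ≤ IsLocalRing.maximalIdeal R ^ t := Ideal.span_le.2 (by
    rintro _ ⟨i, hi, rfl⟩
    exact Ideal.pow_le_pow_right (Nat.le_succ t) (Ideal.pow_mem_pow (hx.2.1 i hi) (t + 1)))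
  have hxJ : IsParameterFamily (fun i => x i ^ (t + 1)) s :=
    hx.of_pow fun i _ => ⟨t + 1, Nat.succ_ne_zero t, rfl⟩
  have hinj : Module.Injective (R ⧸ J) (R ⧸ J) :=
    hxJ.injective_of_ker_eq _ hR rfl (Ideal.Quotient.mk J) Ideal.Quotient.mk_surjective
      Ideal.mk_ker
  have hprod : ∀ b ∈ Ideal.span (x '' s), b * ∏ i ∈ s, x i ^ t ∈ J := by
    intro b hb
    induction hb using Submodule.span_induction with
    | mem b hb =>
      obtain ⟨i, hi, rfl⟩ := hb
      rw [← Finset.mul_prod_erase s _ hi, ← mul_assoc, ← pow_succ']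
      exact Ideal.mul_mem_right _ _ (Ideal.subset_span ⟨i, hi, rfl⟩)
    | zero => rw [zero_mul]; exact J.zero_mem
    | add b c _ _ hb hc => rw [add_mul]; exact J.add_mem hb hc
    | smul a b _ hb => rw [smul_eq_mul, mul_assoc]; exact J.mul_mem_left a hb
  obtain ⟨f, hf⟩ := exists_linearMap_apply_eq (S := R ⧸ J) (N := N ⧸ J • (⊤ : Submodule R N)) hinj
    (Submodule.Quotient.mk w) (Ideal.Quotient.mk J (v * ∏ i ∈ s, x i ^ t)) (by
      intro r hr
      obtain ⟨r, rfl⟩ := Ideal.Quotient.mk_surjective r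
      have hr' : r • w ∈ J • (⊤ : Submodule R N) :=
        (Submodule.Quotient.mk_eq_zero _).1 hr
      have hrm : r ∈ IsLocalRing.maximalIdeal R := by
        by_contra hc
        rw [IsLocalRing.mem_maximalIdeal, mem_nonunits_iff, not_not] at hc
        exact ht (Submodule.smul_mono_left hJm
          ((Submodule.smul_mem_iff_of_isUnit _ hc).1 hr'))
      rw [smul_eq_mul, ← map_mul, ← mul_assoc]
      exact Ideal.Quotient.eq_zero_iff_mem.2 (hprod _ (hv r hrm)))
  exact ⟨(f.restrictScalars R) ∘ₗ (J • (⊤ : Submodule R N)).mkQ, hf⟩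

/-- For a nonzero vector `w` killed by `𝔪` in an injective module, `a ⊗ w` vanishes exactly when
`a` lies in the colon ideal `I^{[q]} : v ^ q`, where `v` generates the socle modulo the parameter
ideal `I`. -/
theorem IsParameterFamily.tmul_eq_zero_iff (hR : IsGorensteinLocalRing R)
    {x : ι → R} {s : Finset ι} (hx : IsParameterFamily x s) {v : R}
    (hv : Submodule.span R {Ideal.Quotient.mk (Ideal.span (x '' s)) v} =
      socle R (R ⧸ Ideal.span (x '' s)))
    (p e : ℕ) [ExpChar R p] {E : Type u} [AddCommGroup E] [Module R E]
    (hE : Module.Injective R E) {w : E} (hw : w ≠ 0)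
    (hmw : ∀ r ∈ IsLocalRing.maximalIdeal R, r • w = 0) (a : R) :
    (show FrobeniusAlgebra R p e from a) ⊗ₜ[R] w = 0 ↔
      a * v ^ p ^ e ∈ frobeniusPower (Ideal.span (x '' s)) (p ^ e) := by
  have := hR.1
  have hvm := hx.mul_mem_iff hv
  constructor
  · intro h
    obtain ⟨N, hwN, hN, h0⟩ := exists_finite_submodule_tmul_eq_zero h
    have : Module.Finite R N := Module.Finite.iff_fg.2 hN
    obtain ⟨t, θ, hθ⟩ := hx.exists_linearMap_quotient_pow hR (fun r hr => (hvm r).2 hr)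
      (w := (⟨w, hwN⟩ : N)) (fun h => hw (congrArg Subtype.val h))
    have h1 := congrArg (θ.lTensor (FrobeniusAlgebra R p e)) h0
    rw [LinearMap.lTensor_tmul, map_zero, hθ, tmul_mk_eq_zero_iff, frobeniusPower_span_image,
      mul_pow, ← mul_assoc, ← Finset.prod_pow] at h1
    rw [frobeniusPower_span_image]
    have hp : p ^ e ≠ 0 := (expChar_pow_pos R p e).ne'
    have hxq : IsParameterFamily (fun i => x i ^ p ^ e) s :=
      hx.of_pow fun i _ => ⟨p ^ e, hp, rfl⟩
    refine hxq.mem_span_of_mul_prod_pow_mem hR t s subset_rfl ?_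
    have h2 : (fun i => if i ∈ s then (x i ^ p ^ e) ^ (t + 1) else x i ^ p ^ e) '' s =
        (fun i => (x i ^ (t + 1)) ^ p ^ e) '' s := Set.image_congr fun i hi => by
      rw [if_pos (Finset.mem_coe.1 hi), pow_right_comm]
    rw [h2]
    simpa only [pow_right_comm _ t] using h1
  · intro h
    obtain ⟨f, hf⟩ := exists_linearMap_apply_eq hE
      (Ideal.Quotient.mk (Ideal.span (x '' s)) v) w fun r hr =>
        hmw r ((hvm r).1 (Ideal.Quotient.eq_zero_iff_mem.1 hr))
    have h1 := congrArg (f.lTensor (FrobeniusAlgebra R p e)) ((tmul_mk_eq_zero_iff _ p e a v).2 h)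
    rwa [LinearMap.lTensor_tmul, map_zero, hf] at h1

end Frobenius

/-! ### Lengths -/

theorem splittingModule_eq_range (R : Type u) [CommRing R] [IsLocalRing R] (p e : ℕ)
    [ExpChar R p] :
    splittingModule R p e = LinearMap.range
      (LinearMap.toSpanSingleton (FrobeniusAlgebra R p e) _
        ((1 : FrobeniusAlgebra R p e) ⊗ₜ[R] residueHullMap R 1)) := by
  refine le_antisymm ?_ ?_
  · rintro _ ⟨z, rfl⟩
    induction z with
    | zero => rw [map_zero]; exact zero_mem _
    | tmul a c =>
      obtain ⟨r, rfl⟩ := IsLocalRing.residue_surjective c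
      refine ⟨r • a, ?_⟩
      rw [LinearMap.baseChange_tmul, LinearMap.toSpanSingleton_apply,
        TensorProduct.smul_tmul', smul_eq_mul, mul_one, TensorProduct.smul_tmul, ← map_smul,
        Algebra.smul_def, mul_one]
      rfl
    | add y z hy hz => rw [map_add]; exact add_mem hy hz
  · rintro _ ⟨a, rfl⟩
    exact Submodule.smul_mem _ a (LinearMap.mem_range.2 ⟨1 ⊗ₜ 1, LinearMap.baseChange_tmul _ _ _⟩)

/-- The submodule of `R ⧸ F` generated by the class of `w` is `R` modulo the colon ideal
`F : w`. -/
theorem length_sup_quotient {R : Type u} [CommRing R] (F : Ideal R) (w : R) (K : Ideal R)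
    (hK : ∀ a, a ∈ K ↔ a * w ∈ F) :
    Module.length R (↥(Ideal.span {w} ⊔ F) ⧸ F.submoduleOf (Ideal.span {w} ⊔ F)) =
      Module.length R (R ⧸ K) := by
  have hw : w ∈ Ideal.span {w} ⊔ F :=
    Ideal.mem_sup_left (Ideal.mem_span_singleton_self w)
  let f : R →ₗ[R] (↥(Ideal.span {w} ⊔ F) ⧸ F.submoduleOf (Ideal.span {w} ⊔ F)) :=
    (Submodule.mkQ _) ∘ₗ LinearMap.toSpanSingleton R _ ⟨w, hw⟩
  have hf : Function.Surjective f := by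
    intro b
    obtain ⟨⟨b, hb⟩, rfl⟩ := Submodule.mkQ_surjective _ b
    obtain ⟨c, hc, g, hg, rfl⟩ := Submodule.mem_sup.1 hb
    obtain ⟨r, rfl⟩ := Ideal.mem_span_singleton'.1 hc
    refine ⟨r, (Submodule.Quotient.eq _).2 ?_⟩
    change r * w - (r * w + g) ∈ F
    rw [sub_add_cancel_left]
    exact F.neg_mem hg
  have hker : LinearMap.ker f = K := by
    ext a
    rw [hK]
    exact Submodule.Quotient.mk_eq_zero _
  rw [← hker]
  exact (LinearMap.quotKerEquivOfSurjective f hf).length_eq.symm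

end FrobeniusSplitting

open FrobeniusSplitting
theorem mainTheorem8 (R : Type u) [CommRing R] [IsLocalRing R] (hR : IsGorensteinLocalRing R)
    (p : ℕ) [Fact p.Prime] [CharP R p] (d : ℕ) (x : Fin d → R) (hx : IsSystemOfParameters x)
    (I : Ideal R) (hI : I = Ideal.span (Set.range x))
    (v : R) (hv : Submodule.span R {Ideal.Quotient.mk I v} = socle R (R ⧸ I))
    (e q : ℕ) (hq : q = p ^ e) (J : Ideal R) (hJ : J = Ideal.span {v ^ q} ⊔ frobeniusPower I q) :
    Module.length R (J ⧸ (frobeniusPower I q).submoduleOf J) ≠ ⊤ ∧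
      normalizedSplittingNumber R p e * (q : ℝ≥0∞) ^ d =
        ((Module.length R (J ⧸ (frobeniusPower I q).submoduleOf J) : ℕ∞) : ℝ≥0∞) := by
  have := hR.1
  have hs := hx.isParameterFamily
  have hI' : I = Ideal.span (x '' (Finset.univ : Finset (Fin d))) := by
    rw [hI, Finset.coe_univ, Set.image_univ]
  have hq0 : q ≠ 0 := hq ▸ pow_ne_zero e (Fact.out : p.Prime).ne_zero
  subst hJ hI' hq
  set F := frobeniusPower (Ideal.span (x '' (Finset.univ : Finset (Fin d)))) (p ^ e) with hF
  -- the annihilator of the generator `1 ⊗ ψ(1)` of `K_e`; `FrobeniusAlgebra R p e` is `R` as a ring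
  let K : Ideal R := (LinearMap.ker (LinearMap.toSpanSingleton (FrobeniusAlgebra R p e) _
        ((1 : FrobeniusAlgebra R p e) ⊗ₜ[R] residueHullMap R 1)) :
          Submodule (FrobeniusAlgebra R p e) (FrobeniusAlgebra R p e))
  have hull := residueHullMap_isInjectiveHull R
  have hw : residueHullMap R 1 ≠ 0 := fun h =>
    one_ne_zero (hull.injective_map (h.trans (map_zero _).symm))
  have hmw : ∀ r ∈ IsLocalRing.maximalIdeal R, r • residueHullMap R 1 = 0 := fun r hr => by
    rw [← map_smul, Algebra.smul_def, mul_one]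
    have : algebraMap R (IsLocalRing.ResidueField R) r = 0 :=
      (IsLocalRing.residue_eq_zero_iff r).2 hr
    rw [this, map_zero]
  have hK : ∀ a, a ∈ K ↔ a * v ^ p ^ e ∈ F := fun a => by
    rw [← hs.tmul_eq_zero_iff hR hv p e hull.injective_module hw hmw a]
    change (show FrobeniusAlgebra R p e from a) •
      ((1 : FrobeniusAlgebra R p e) ⊗ₜ[R] residueHullMap R 1) = 0 ↔ _
    rw [TensorProduct.smul_tmul', smul_eq_mul, mul_one]
  have hlen := length_sup_quotient F (v ^ p ^ e) K hK
  have hKe : Module.length (FrobeniusAlgebra R p e) (splittingModule R p e) =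
      Module.length R (R ⧸ K) := by
    rw [splittingModule_eq_range]
    exact (LinearMap.quotKerEquivRange _).length_eq.symm
  refine ⟨?_, ?_⟩
  · rw [hlen]
    have hFK : F ≤ K := fun a ha => (hK a).2 (F.mul_mem_right _ ha)
    have hpow : IsParameterFamily (fun i => x i ^ p ^ e) Finset.univ :=
      hs.of_pow fun i _ => ⟨p ^ e, hq0, rfl⟩
    have hfin := hpow.length_ne_top
    rw [← frobeniusPower_span_image] at hfin
    exact ne_top_of_le_ne_top hfin (Module.length_le_of_surjective
      (Submodule.factor hFK) (Submodule.factor_surjective hFK))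
  · rw [normalizedSplittingNumber, hKe, hlen, hx.1]
    have h1 : ((p ^ e : ℕ) : ℝ≥0∞) = (p : ℝ≥0∞) ^ e := Nat.cast_pow p e
    have h2 : ((d : WithBot ℕ∞).unbotD 0).toNat = d := rfl
    rw [h1, h2]
    have hp : (p : ℝ≥0∞) ^ e ≠ 0 := by rw [← h1]; exact_mod_cast hq0
    exact ENNReal.div_mul_cancel (pow_ne_zero d hp)
      (ENNReal.pow_ne_top (ENNReal.pow_ne_top (ENNReal.natCast_ne_top p)))
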